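/- Let $\mathcal H$ and $\mathcal H_i$ ($i\in N$, $N$ a finite set of shares) be finite-dimensional complex Hilbert spaces, $\mathcal H\neq 0$, and write $\mathcal H_X=\bigotimes_{i\in X}\mathcal H_i$ for $X\subseteq N$. A quantum operation is a completely positive trace-preserving map. A quantum operation $\mathcal E$ with input space $\mathcal H$ is *reversible* if there is a quantum operation $\mathcal R$ with $\mathcal R(\mathcal E(\rho))=\rho$ for all density operators $\rho$ on $\mathcal H$, and *vanishing* if there is a density operator $\rho_0$ with $\mathcal E(\rho)=\rho_0$ for all density operators $\rho$ on $\mathcal H$. A QSS scheme on $N$ is a reversible quantum operation $W_N$ from operators on $\mathcal H$ to operators on $\mathcal H_N$. It is a pure-state scheme if it sends pure states to pure states, and a mixed-state scheme otherwise. A set $X\subseteq N$ is *qualified* (resp. *forbidden*) for $W_N$ if $W_X=\mathrm{Tr}_{N\setminus X}\circ W_N$ is reversible (resp. vanishing), and *intermediate* if it is neither. The access structure of $W_N$ is the list of its forbidden, intermediate and qualified sets. Let $W_N$ be a mixed-state QSS scheme, let $Z$ be an additional share, and put $N'=N\cup\{Z\}$. 1. There are a finite-dimensional Hilbert space $\mathcal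 H_Z$ and an isometry $V:\mathcal H\to\mathcal H_N\otimes\mathcal H_Z$ such that $W_{N'}(\rho)=V\rho V^*$ is a pure-state QSS scheme on $N'$ and $W_N=\mathrm{Tr}_Z\circ W_{N'}$; that is, $W_N$ is realized by discarding the share $Z$ from $W_{N'}$. 2. For every finite-dimensional Hilbert space $\mathcal H_Z$ and every pure-state QSS scheme $W_{N'}$ on $N'$ with $W_N=\mathrm{Tr}_Z\circ W_{N'}$, the access structure of $W_{N'}$ is uniquely determined by that of $W_N$: there is a map $F$, depending only on the set $N$, from access structures on $N$ to access structures on $N'$ that sends the access structure of $W_N$ to that of $W_{N'}$, for all such $W_N$ and $W_{N'}$. Explicitly, a set $X\subseteq N$ is qualified (resp. forbidden, intermediate) for $W_{N'}$ if and only if it is so for $W_N$; and a set $Y\subseteq N'$ with $Z\in Y$ is qualified (resp. forbidden, intermediate) for $W_{N'}$ if and only if $N'\setminus Y$ is forbidden (resp. qualified, intermediate) for $W_{N'}$. -/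

import Mathlib

open scoped Matrix ComplexOrder

noncomputable section

namespace QSS

section Channels

variable {a b c : Type*} [Fintype a] [DecidableEq a] [Fintype b] [DecidableEq b]

/-- Density operators on the Hilbert space `ℂ^a`. -/
def IsDensity (ρ : Matrix a a ℂ) : Prop :=
  ρ.PosSemidef ∧ ρ.trace = 1

/-- Pure states: the rank one projections `|ψ⟩⟨ψ|` with `ψ` a unit vector. -/
def IsPureState (ρ : Matrix a a ℂ) : Prop :=
  ∃ ψ : a → ℂ, star ψ ⬝ᵥ ψ = 1 ∧ ρ = Matrix.vecMulVec ψ (star ψ)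

/-- The map `id_k ⊗ E` on `k × k` block matrices with blocks in `L(ℂ^a)`. -/
def ampliation (k : ℕ) (E : Matrix a a ℂ →ₗ[ℂ] Matrix b b ℂ)
    (M : Matrix (Fin k × a) (Fin k × a) ℂ) : Matrix (Fin k × b) (Fin k × b) ℂ :=
  Matrix.of fun p q => E (Matrix.of fun i j => M (p.1, i) (q.1, j)) p.2 q.2

/-- Quantum operations: completely positive and trace preserving maps. -/
structure IsQuantumOperation (E : Matrix a a ℂ →ₗ[ℂ] Matrix b b ℂ) : Prop where
  completelyPositive : ∀ (k : ℕ) (M : Matrix (Fin k × a) (Fin k × a) ℂ),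
    M.PosSemidef → (ampliation k E M).PosSemidef
  tracePreserving : ∀ M : Matrix a a ℂ, (E M).trace = M.trace

/-- `E` is reversible with respect to the set `S` of states. -/
def IsReversible (E : Matrix a a ℂ →ₗ[ℂ] Matrix b b ℂ) (S : Set (Matrix a a ℂ)) : Prop :=
  ∃ R : Matrix b b ℂ →ₗ[ℂ] Matrix a a ℂ, IsQuantumOperation R ∧ ∀ ρ ∈ S, R (E ρ) = ρ

/-- `E` is vanishing with respect to the set `S` of states. -/
def IsVanishing (E : Matrix a a ℂ →ₗ[ℂ] Matrix b b ℂ) (S : Set (Matrix a a ℂ)) : Prop :=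
  ∃ ρ₀ : Matrix b b ℂ, IsDensity ρ₀ ∧ ∀ ρ ∈ S, E ρ = ρ₀

/-- Pure state channels send pure states to pure states. -/
def IsPureStateChannel (E : Matrix a a ℂ →ₗ[ℂ] Matrix b b ℂ) : Prop :=
  ∀ ρ : Matrix a a ℂ, IsPureState ρ → IsPureState (E ρ)

/-- The map `ρ ↦ V ρ V*`. -/
def conjMap (V : Matrix b a ℂ) : Matrix a a ℂ →ₗ[ℂ] Matrix b b ℂ where
  toFun ρ := V * ρ * Vᴴ
  map_add' ρ σ := by rw [Matrix.mul_add, Matrix.add_mul]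
  map_smul' t ρ := by simp

/-- With respect to an identification `e : c ≃ a × b` of basis labels (that is, `ℂ^c` is
identified with `ℂ^a ⊗ ℂ^b`), the partial trace over the second tensor factor `ℂ^b`. -/
def partialTrace (e : c ≃ a × b) : Matrix c c ℂ →ₗ[ℂ] Matrix a a ℂ where
  toFun M := Matrix.of fun i j => ∑ k : b, M (e.symm (i, k)) (e.symm (j, k))
  map_add' M M' := by
    ext i j
    simp [Finset.sum_add_distrib]
  map_smul' t M := by
    ext i j
    simp [Finset.mul_sum]

end Channels

section Shares

variable {ι : Type*} [Fintype ι] [DecidableEq ι]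

/-- Labels of the product basis of `H_N = ⨂ i, H_i`, where the share `H_i` is `ℂ^(d i)`. -/
abbrev Label (d : ι → ℕ) : Type _ := ∀ i, Fin (d i)

/-- Labels of the product basis of `H_X = ⨂ i ∈ X, H_i`. -/
abbrev SubLabel (d : ι → ℕ) (X : Finset ι) : Type _ := ∀ i : {i // i ∈ X}, Fin (d i)

/-- An encoder from operators on `H = ℂ^h` to operators on `H_N`. -/
abbrev Encoder (h : ℕ) (d : ι → ℕ) : Type _ :=
  Matrix (Fin h) (Fin h) ℂ →ₗ[ℂ] Matrix (Label d) (Label d) ℂ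

/-- The restricted encoder `W_X = Tr_{N \ X} ∘ W_N`. -/
def restrict {h : ℕ} {d : ι → ℕ} (W : Encoder h d) (X : Finset ι) :
    Matrix (Fin h) (Fin h) ℂ →ₗ[ℂ] Matrix (SubLabel d X) (SubLabel d X) ℂ :=
  (partialTrace (Equiv.piEquivPiSubtypeProd (fun i => i ∈ X) (fun i => Fin (d i)))).comp W

/-- A quantum secret sharing scheme: a quantum operation that is reversible with respect to
all the states of `H`. -/
def IsScheme {h : ℕ} {d : ι → ℕ} (W : Encoder h d) : Prop :=
  IsQuantumOperation W ∧ IsReversible W {ρ | IsDensity ρ}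

/-- Pure state schemes. -/
def IsPureScheme {h : ℕ} {d : ι → ℕ} (W : Encoder h d) : Prop :=
  IsScheme W ∧ IsPureStateChannel W

/-- Mixed state schemes: the schemes that are not pure state schemes. -/
def IsMixedScheme {h : ℕ} {d : ι → ℕ} (W : Encoder h d) : Prop :=
  IsScheme W ∧ ¬ IsPureStateChannel W

/-- `X` is qualified. -/
def IsQualified {h : ℕ} {d : ι → ℕ} (W : Encoder h d) (X : Finset ι) : Prop :=
  IsReversible (restrict W X) {ρ | IsDensity ρ}

/-- `X` is forbidden. -/
def IsForbidden {h : ℕ} {d : ι → ℕ} (W : Encoder h d) (X : Finset ι) : Prop :=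
  IsVanishing (restrict W X) {ρ | IsDensity ρ}

/-- `X` is intermediate: neither qualified nor forbidden. -/
def IsIntermediate {h : ℕ} {d : ι → ℕ} (W : Encoder h d) (X : Finset ι) : Prop :=
  ¬ IsQualified W X ∧ ¬ IsForbidden W X

/-- An access structure on the set `ι` of shares: the list of the forbidden, intermediate and
qualified sets. For `2 ≤ h` the three properties partition the sets of shares, so this is a map
from sets of shares to three labels; for `h = 1` every set is both forbidden and qualified. -/
structure AccessStructure (ι : Type*) where
  forbidden : Set (Finset ι)
  intermediate : Set (Finset ι)
  qualified : Set (Finset ι)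

/-- The access structure of an encoder. -/
def accessStructure {h : ℕ} {d : ι → ℕ} (W : Encoder h d) : AccessStructure ι where
  forbidden := {X | IsForbidden W X}
  intermediate := {X | IsIntermediate W X}
  qualified := {X | IsQualified W X}

/-- The dimensions of the shares `N' = N ∪ {Z}`, where `Z` is the share `none : Option ι`, of
dimension `z`. -/
def addShare (d : ι → ℕ) (z : ℕ) : Option ι → ℕ
  | none => z
  | some i => d i

/-- The identification `H_{N'} = H_N ⊗ H_Z` on labels of the product basis. -/
def splitShare (d : ι → ℕ) (z : ℕ) : Label (addShare d z) ≃ Label d × Fin z where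
  toFun f := (fun i => f (some i), f none)
  invFun q o := match o with
    | none => q.2
    | some i => q.1 i
  left_inv f := by
    funext o
    cases o <;> rfl
  right_inv _ := rfl

/-- Discarding the share `Z = none`: the encoder `Tr_Z ∘ W_{N'}`, with values in operators
on `H_N`. -/
def discardShare {h : ℕ} {d : ι → ℕ} {z : ℕ} (W : Encoder h (addShare d z)) : Encoder h d :=
  (partialTrace (splitShare d z)).comp W

end Shares

end QSS

end

/-!
A quantum operation with Kraus operators `K i` is reversible exactly when it satisfies the
Knill–Laflamme condition `(K i)* K j = l i j • 1`. Since the output of the complementary channel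
on `ρ` has the entries `tr ((K j)* K i ρ)`, the same condition says that the complementary channel
is vanishing. In a pure state scheme, the Knill–Laflamme condition splits the encoder into
isometries with orthogonal ranges, and purity leaves only one of them; hence the encoder is
`ρ ↦ V ρ V*` for an isometry `V`, its restrictions to `X` and to the complement of `X` are
complementary channels, and `X` is qualified exactly when its complement is forbidden. Stinespring's
theorem provides the pure state scheme on `N ∪ {Z}`, and restricting to `X ⊆ N` does not see
whether `Z` has been discarded before.
-/

namespace QSS

open Matrix

section DensityOperators

variable {a : Type*} [Fintype a]

theorem IsPureState.isDensity {ρ : Matrix a a ℂ} (hρ : IsPureState ρ) : IsDensity ρ := by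
  obtain ⟨ψ, hψ, rfl⟩ := hρ
  exact ⟨posSemidef_vecMulVec_self_star ψ, by rw [trace_vecMulVec, dotProduct_comm, hψ]⟩

theorem IsPureState.mul_self {ρ : Matrix a a ℂ} (hρ : IsPureState ρ) : ρ * ρ = ρ := by
  obtain ⟨ψ, hψ, rfl⟩ := hρ
  rw [vecMulVec_mul_vecMulVec, hψ, one_smul]

theorem exists_isPureState [Nonempty a] : ∃ ρ : Matrix a a ℂ, IsPureState ρ := by
  classical
  obtain ⟨x⟩ := ‹Nonempty a›
  exact ⟨_, Pi.single x 1, by simp, rfl⟩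

theorem ext_isDensity {M : Type*} [AddCommMonoid M] [Module ℂ M] {E F : Matrix a a ℂ →ₗ[ℂ] M}
    (h : ∀ ρ, IsDensity ρ → E ρ = F ρ) : E = F := by
  classical
  open scoped MatrixOrder Matrix.Norms.L2Operator in
  refine LinearMap.ext_on CStarAlgebra.span_nonneg fun (A : Matrix a a ℂ) hA => ?_
  have hA : A.PosSemidef := Matrix.nonneg_iff_posSemidef.mp hA
  by_cases ht : A.trace = 0
  · rw [hA.trace_eq_zero_iff.mp ht, map_zero, map_zero]
  · have hdens : IsDensity (A.trace⁻¹ • A) :=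
      ⟨hA.smul (inv_nonneg.mpr hA.trace_nonneg), by
        rw [trace_smul, smul_eq_mul, inv_mul_cancel₀ ht]⟩
    calc E A = A.trace • E (A.trace⁻¹ • A) := by rw [← map_smul, smul_inv_smul₀ ht]
      _ = A.trace • F (A.trace⁻¹ • A) := by rw [h _ hdens]
      _ = F A := by rw [← map_smul, smul_inv_smul₀ ht]

theorem trace_mul_eq_const_iff [DecidableEq a] {A : Matrix a a ℂ} {t : ℂ} :
    (∀ ρ, IsDensity ρ → (A * ρ).trace = t) ↔ A = t • 1 := by
  constructor
  · intro h
    have hmap : traceLinearMap a ℂ ℂ ∘ₗ LinearMap.mulLeft ℂ A = t • traceLinearMap a ℂ ℂ :=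
      ext_isDensity fun ρ hρ => by simp [h ρ hρ, hρ.2]
    refine ext_iff_trace_mul_right.mpr fun M => ?_
    simpa using LinearMap.congr_fun hmap M
  · rintro rfl ρ hρ
    simp [hρ.2]

end DensityOperators

section QuantumOperations

variable {a b c : Type*}

section Composition

variable [Fintype a] [Fintype b] [Fintype c]

theorem IsQuantumOperation.isDensity {E : Matrix a a ℂ →ₗ[ℂ] Matrix b b ℂ}
    (hE : IsQuantumOperation E) {ρ : Matrix a a ℂ} (hρ : IsDensity ρ) : IsDensity (E ρ) :=
  ⟨(hE.completelyPositive 1 _ (hρ.1.submatrix Prod.snd)).submatrix fun i => (0, i),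
    (hE.tracePreserving ρ).trans hρ.2⟩

theorem IsQuantumOperation.comp {F : Matrix b b ℂ →ₗ[ℂ] Matrix c c ℂ}
    {E : Matrix a a ℂ →ₗ[ℂ] Matrix b b ℂ} (hF : IsQuantumOperation F)
    (hE : IsQuantumOperation E) : IsQuantumOperation (F ∘ₗ E) where
  completelyPositive k M hM := hF.completelyPositive k _ (hE.completelyPositive k M hM)
  tracePreserving M := (hF.tracePreserving _).trans (hE.tracePreserving M)

theorem isQuantumOperation_reindex (f : a ≃ b) :
    IsQuantumOperation (reindexLinearEquiv ℂ ℂ f f).toLinearMap where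
  completelyPositive k _ hM := hM.submatrix fun p : Fin k × b => (p.1, f.symm p.2)
  tracePreserving M := f.symm.sum_comp fun i => M i i

end Composition

variable {E : Matrix a a ℂ →ₗ[ℂ] Matrix b b ℂ} {S : Set (Matrix a a ℂ)}

theorem IsReversible.of_comp [Fintype a] [Fintype b] [Fintype c]
    {F : Matrix b b ℂ →ₗ[ℂ] Matrix c c ℂ} (hF : IsQuantumOperation F)
    (h : IsReversible (F ∘ₗ E) S) : IsReversible E S := by
  obtain ⟨R, hR, hRE⟩ := h
  exact ⟨R ∘ₗ F, hR.comp hF, hRE⟩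

theorem IsVanishing.comp [Fintype b] [Fintype c] {F : Matrix b b ℂ →ₗ[ℂ] Matrix c c ℂ}
    (hF : IsQuantumOperation F) (h : IsVanishing E S) : IsVanishing (F ∘ₗ E) S := by
  obtain ⟨ρ₀, hρ₀, hE⟩ := h
  exact ⟨F ρ₀, hF.isDensity hρ₀, fun ρ hρ => congrArg F (hE ρ hρ)⟩

theorem reindex_symm_comp_reindex_comp (f : b ≃ c) :
    (reindexLinearEquiv ℂ ℂ f.symm f.symm).toLinearMap ∘ₗ
      (reindexLinearEquiv ℂ ℂ f f).toLinearMap ∘ₗ E = E :=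
  LinearMap.ext fun ρ => (reindexLinearEquiv ℂ ℂ f f).symm_apply_apply (E ρ)

theorem isReversible_reindex_comp_iff [Fintype a] [Fintype b] [Fintype c] (f : b ≃ c) :
    IsReversible ((reindexLinearEquiv ℂ ℂ f f).toLinearMap ∘ₗ E) S ↔ IsReversible E S := by
  refine ⟨.of_comp (isQuantumOperation_reindex f), fun h => ?_⟩
  refine .of_comp (isQuantumOperation_reindex f.symm) ?_
  rwa [reindex_symm_comp_reindex_comp]

theorem isVanishing_reindex_comp_iff [Fintype b] [Fintype c] (f : b ≃ c) :
    IsVanishing ((reindexLinearEquiv ℂ ℂ f f).toLinearMap ∘ₗ E) S ↔ IsVanishing E S := by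
  refine ⟨fun h => ?_, .comp (isQuantumOperation_reindex f)⟩
  rw [← reindex_symm_comp_reindex_comp (E := E) f]
  exact h.comp (isQuantumOperation_reindex f.symm)

end QuantumOperations

section KrausMaps

variable {a b c κ : Type*} [Fintype a]

theorem conjMap_apply (V : Matrix b a ℂ) (ρ : Matrix a a ℂ) : conjMap V ρ = V * ρ * Vᴴ := rfl

theorem conjMap_one [DecidableEq a] : conjMap (1 : Matrix a a ℂ) = LinearMap.id := by
  ext1 ρ
  simp [conjMap_apply]

theorem conjMap_zero : conjMap (0 : Matrix b a ℂ) = 0 := by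
  ext1 ρ
  simp [conjMap_apply]

theorem conjMap_smul (t : ℝ) (V : Matrix b a ℂ) : conjMap (t • V) = (t * t) • conjMap V := by
  ext1 ρ
  simp [conjMap_apply, smul_smul]

theorem ampliation_conjMap (k : ℕ) (V : Matrix b a ℂ) (M : Matrix (Fin k × a) (Fin k × a) ℂ) :
    ampliation k (conjMap V) M =
      kronecker (1 : Matrix (Fin k) (Fin k) ℂ) V * M *
        (kronecker (1 : Matrix (Fin k) (Fin k) ℂ) V)ᴴ := by
  ext ⟨p, s⟩ ⟨q, t⟩
  simp [ampliation, conjMap_apply, Matrix.mul_apply, Fintype.sum_prod_type, Matrix.one_apply,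
    ite_mul, apply_ite]

variable [Fintype κ]

/-- The completely positive map `ρ ↦ ∑ i, K i ρ (K i)*` with Kraus operators `K i`. -/
def krausMap (K : κ → Matrix b a ℂ) : Matrix a a ℂ →ₗ[ℂ] Matrix b b ℂ :=
  ∑ i, conjMap (K i)

theorem krausMap_apply (K : κ → Matrix b a ℂ) (ρ : Matrix a a ℂ) :
    krausMap K ρ = ∑ i, K i * ρ * (K i)ᴴ := by
  simp [krausMap, LinearMap.sum_apply, conjMap_apply]

theorem krausMap_unique {κ : Type*} [Unique κ] (K : κ → Matrix b a ℂ) :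
    krausMap K = conjMap (K default) :=
  Fintype.sum_unique _

theorem krausMap_comp_conjMap [Fintype b] (K : κ → Matrix c b ℂ) (U : Matrix b a ℂ) :
    krausMap K ∘ₗ conjMap U = krausMap fun i => K i * U := by
  ext1 ρ
  simp [krausMap_apply, conjMap_apply, Matrix.mul_assoc]

theorem krausMap_comp_krausMap {κ' : Type*} [Fintype b] [Fintype κ'] (L : κ' → Matrix c b ℂ)
    (K : κ → Matrix b a ℂ) :
    krausMap L ∘ₗ krausMap K = krausMap fun p : κ' × κ => L p.1 * K p.2 := by
  ext1 ρ
  simp only [LinearMap.comp_apply, krausMap_apply, Fintype.sum_prod_type, Matrix.mul_sum,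
    Matrix.sum_mul, Matrix.mul_assoc, conjTranspose_mul]

theorem trace_krausMap [Fintype b] (K : κ → Matrix b a ℂ) (ρ : Matrix a a ℂ) :
    (krausMap K ρ).trace = ((∑ i, (K i)ᴴ * K i) * ρ).trace := by
  simp only [krausMap_apply, trace_sum, Matrix.sum_mul]
  exact Finset.sum_congr rfl fun i _ => by rw [Matrix.trace_mul_comm, Matrix.mul_assoc]

theorem posSemidef_ampliation_krausMap [Finite b] (K : κ → Matrix b a ℂ) (k : ℕ)
    {M : Matrix (Fin k × a) (Fin k × a) ℂ} (hM : M.PosSemidef) :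
    (ampliation k (krausMap K) M).PosSemidef := by
  have hsum : ampliation k (krausMap K) M = ∑ i, ampliation k (conjMap (K i)) M := by
    ext p q
    simp [ampliation, krausMap, Matrix.sum_apply, LinearMap.sum_apply]
  rw [hsum]
  refine posSemidef_sum _ fun i _ => ?_
  rw [ampliation_conjMap]
  exact hM.mul_mul_conjTranspose_same _

theorem isQuantumOperation_krausMap_iff [Fintype b] [DecidableEq a] {K : κ → Matrix b a ℂ} :
    IsQuantumOperation (krausMap K) ↔ ∑ i, (K i)ᴴ * K i = 1 := by
  constructor
  · intro h
    refine ext_iff_trace_mul_right.mpr fun M => ?_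
    rw [← trace_krausMap, h.tracePreserving, Matrix.one_mul]
  · intro h
    exact ⟨fun k _ => posSemidef_ampliation_krausMap K k,
      fun M => by rw [trace_krausMap, h, Matrix.one_mul]⟩

theorem krausMap_sum_smul_unitary [DecidableEq κ] (K : κ → Matrix b a ℂ)
    (U : unitaryGroup κ ℂ) : krausMap (fun m => ∑ k, U.1 k m • K k) = krausMap K := by
  ext1 ρ
  have hU : ∀ k l, ∑ m, U.1 k m * star (U.1 l m) = if k = l then 1 else 0 := fun k l => by
    simpa [Matrix.mul_apply, Matrix.one_apply] using congrFun₂ (Unitary.coe_mul_star_self U) k l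
  calc krausMap (fun m => ∑ k, U.1 k m • K k) ρ
      = ∑ m, ∑ l, ∑ k, (U.1 k m * star (U.1 l m)) • (K k * ρ * (K l)ᴴ) := by
        simp only [krausMap_apply, conjTranspose_sum, conjTranspose_smul, Matrix.sum_mul,
          Matrix.mul_sum, Matrix.smul_mul, Matrix.mul_smul, Finset.smul_sum, smul_smul, mul_comm]
    _ = ∑ l, ∑ k, ∑ m, (U.1 k m * star (U.1 l m)) • (K k * ρ * (K l)ᴴ) := by
        rw [Finset.sum_comm]
        exact Finset.sum_congr rfl fun l _ => Finset.sum_comm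
    _ = krausMap K ρ := by
        simp only [← Finset.sum_smul, hU, krausMap_apply, ite_smul, one_smul, zero_smul,
          Finset.sum_ite_eq', Finset.mem_univ, if_true]

end KrausMaps

section ChoiMatrix

variable {a b κ : Type*} [DecidableEq a]

/-- The Choi matrix `∑ i j, |i⟩⟨j| ⊗ E(|i⟩⟨j|)`, which encodes a linear map of matrix algebras. -/
def choiMatrix (E : Matrix a a ℂ →ₗ[ℂ] Matrix b b ℂ) : Matrix (a × b) (a × b) ℂ :=
  Matrix.of fun p q => E (single p.1 q.1 1) p.2 q.2

theorem choiMatrix_injective [Finite a] :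
    Function.Injective (choiMatrix : (Matrix a a ℂ →ₗ[ℂ] Matrix b b ℂ) → _) := by
  intro E F h
  refine ext_linearMap _ fun i j => LinearMap.ext_ring ?_
  ext s t
  exact congrFun₂ h (i, s) (j, t)

variable [Fintype a]

theorem choiMatrix_krausMap [Fintype κ] (K : κ → Matrix b a ℂ) (p q : a × b) :
    choiMatrix (krausMap K) p q = ∑ k, K k p.2 p.1 * star (K k q.2 q.1) := by
  simp [choiMatrix, krausMap_apply, Matrix.sum_apply, Matrix.mul_apply, single, ite_and]

theorem IsQuantumOperation.posSemidef_choiMatrix [Fintype b]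
    {E : Matrix a a ℂ →ₗ[ℂ] Matrix b b ℂ} (hE : IsQuantumOperation E) :
    (choiMatrix E).PosSemidef := by
  let e := Fintype.equivFin a
  let Ω : Fin (Fintype.card a) × a → ℂ := fun p => if e p.2 = p.1 then 1 else 0
  have hΩ := hE.completelyPositive _ _ (posSemidef_vecMulVec_self_star Ω)
  convert hΩ.submatrix (Prod.map e id) using 1
  ext p q
  refine congrFun₂ (congrArg E ?_) p.2 q.2
  ext x y
  simp [Ω, vecMulVec_apply, single, ← ite_and, eq_comm, and_comm]

-- Comparing entries, `∑ m, L m p i * star (L m q j) = δ p i * δ q j`, so that the vectors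
-- `m ↦ L m p i` with `p ≠ i` and `m ↦ L m p p - L m x x` have norm zero.
theorem exists_eq_smul_one_of_krausMap_eq_id [Fintype κ] {L : κ → Matrix a a ℂ}
    (hL : krausMap L = LinearMap.id) (m : κ) : ∃ t : ℂ, L m = t • 1 := by
  have hentry : ∀ p q i j, ∑ m, L m p i * star (L m q j) = if p = i ∧ q = j then 1 else 0 := by
    intro p q i j
    rw [← choiMatrix_krausMap L (i, p) (j, q), hL]
    simp [choiMatrix, single, eq_comm]
  have hzero : ∀ f : κ → ℂ, ∑ m, f m * star (f m) = 0 → f m = 0 := fun f hf =>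
    congrFun (dotProduct_self_star_eq_zero.mp hf) m
  rcases isEmpty_or_nonempty a with ha | ⟨⟨x⟩⟩
  · exact ⟨0, Subsingleton.elim _ _⟩
  refine ⟨L m x x, ?_⟩
  ext p i
  by_cases hpi : p = i
  · subst hpi
    have hdiff : L m p p - L m x x = 0 := hzero (fun m => L m p p - L m x x) (by
      simp only [star_sub, sub_mul, mul_sub, Finset.sum_sub_distrib, hentry, and_self, if_true,
        sub_self])
    simpa using sub_eq_zero.mp hdiff
  · simpa [hpi] using hzero (fun m => L m p i) (by rw [hentry, if_neg (hpi ·.1)])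

end ChoiMatrix

-- Choi's theorem: the rows of a factor `B` of the Choi matrix `Bᴴ * B` are the Kraus operators.
theorem IsQuantumOperation.exists_eq_krausMap {a b : Type*} [Fintype a] [Fintype b]
    {E : Matrix a a ℂ →ₗ[ℂ] Matrix b b ℂ} (hE : IsQuantumOperation E) :
    ∃ K : a × b → Matrix b a ℂ, E = krausMap K := by
  classical
  obtain ⟨B, hB⟩ : ∃ B : Matrix (a × b) (a × b) ℂ, choiMatrix E = Bᴴ * B := by
    open scoped MatrixOrder in
    exact CStarAlgebra.nonneg_iff_eq_star_mul_self.mp hE.posSemidef_choiMatrix.nonneg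
  refine ⟨fun r => Matrix.of fun s i => star (B r (i, s)), choiMatrix_injective ?_⟩
  ext p q
  simp [hB, choiMatrix_krausMap, Matrix.mul_apply]


section KnillLaflamme

variable {a b κ : Type*} [Fintype b]

/-- The Knill–Laflamme condition: the errors `K i` map the code space `ℂ^a` onto subspaces whose
mutual position does not depend on the encoded state. -/
def IsKnillLaflamme [DecidableEq a] (K : κ → Matrix b a ℂ) : Prop :=
  ∃ l : Matrix κ κ ℂ, ∀ i j, (K i)ᴴ * K j = l i j • 1

/-- `E` is the mixture, with the positive weights `p i`, of the isometric channels
`ρ ↦ W i ρ (W i)*` with pairwise orthogonal ranges. -/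
structure IsOrthogonalMixture [Fintype a] [DecidableEq a] [Fintype κ] [DecidableEq κ] (p : κ → ℝ)
    (W : κ → Matrix b a ℂ) (E : Matrix a a ℂ →ₗ[ℂ] Matrix b b ℂ) : Prop where
  pos : ∀ i, 0 < p i
  sum_eq_one : ∑ i, p i = 1
  orthonormal : ∀ i j, (W i)ᴴ * W j = if i = j then 1 else 0
  eq_sum : E = ∑ i, p i • conjMap (W i)

theorem IsKnillLaflamme.exists_isHermitian [DecidableEq a] [Nonempty a] {K : κ → Matrix b a ℂ}
    (hK : IsKnillLaflamme K) :
    ∃ l : Matrix κ κ ℂ, l.IsHermitian ∧ ∀ i j, (K i)ᴴ * K j = l i j • 1 := by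
  obtain ⟨l, hl⟩ := hK
  obtain ⟨x⟩ := ‹Nonempty a›
  have hentry : ∀ i j, l i j = ((K i)ᴴ * K j) x x := fun i j => by simp [hl]
  refine ⟨l, Matrix.ext fun i j => ?_, hl⟩
  simp [hentry, Matrix.mul_apply, mul_comm]

theorem nonneg_of_conjTranspose_mul_self_eq_smul_one [DecidableEq a] [Nonempty a]
    {A : Matrix b a ℂ} {t : ℝ} (h : Aᴴ * A = t • 1) : 0 ≤ t := by
  obtain ⟨x⟩ := ‹Nonempty a›
  have hx : 0 ≤ (Aᴴ * A) x x := by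
    simp only [Matrix.mul_apply, conjTranspose_apply]
    exact Finset.sum_nonneg fun k _ => star_mul_self_nonneg _
  simpa [h] using hx

variable [Fintype a] [DecidableEq a] [Fintype κ]

theorem IsReversible.isKnillLaflamme {K : κ → Matrix b a ℂ}
    (h : IsReversible (krausMap K) {ρ | IsDensity ρ}) : IsKnillLaflamme K := by
  classical
  obtain ⟨R, hR, hRK⟩ := h
  obtain ⟨T, rfl⟩ := hR.exists_eq_krausMap
  have hid : krausMap (fun p : (b × a) × κ => T p.1 * K p.2) = LinearMap.id := by
    rw [← krausMap_comp_krausMap]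
    exact ext_isDensity hRK
  choose t ht using fun m i => exists_eq_smul_one_of_krausMap_eq_id hid (m, i)
  refine ⟨of fun i j => ∑ m, star (t m i) * t m j, fun i j => ?_⟩
  calc (K i)ᴴ * K j
      = (K i)ᴴ * (∑ m, (T m)ᴴ * T m) * K j := by
        rw [isQuantumOperation_krausMap_iff.mp hR, Matrix.mul_one]
    _ = ∑ m, (T m * K i)ᴴ * (T m * K j) := by
        simp only [Matrix.mul_sum, Matrix.sum_mul, conjTranspose_mul, Matrix.mul_assoc]
    _ = (∑ m, star (t m i) * t m j) • 1 := by
        simp [ht, Finset.sum_smul, smul_smul, mul_comm]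

theorem IsKnillLaflamme.exists_diagonal [DecidableEq κ] [Nonempty a] {K : κ → Matrix b a ℂ}
    (hK : IsKnillLaflamme K) :
    ∃ (F : κ → Matrix b a ℂ) (D : κ → ℝ), krausMap F = krausMap K ∧
      ∀ i j, (F i)ᴴ * F j = if i = j then D i • 1 else 0 := by
  obtain ⟨l, hherm, hl⟩ := hK.exists_isHermitian
  let U := hherm.eigenvectorUnitary
  have hdiag : star U.1 * l * U.1 = diagonal fun i => (hherm.eigenvalues i : ℂ) := by
    rw [← Unitary.conjStarAlgAut_star_apply (S := ℂ), hherm.conjStarAlgAut_star_eigenvectorUnitary]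
    rfl
  refine ⟨fun m => ∑ k, U.1 k m • K k, hherm.eigenvalues, krausMap_sum_smul_unitary K U,
    fun i j => ?_⟩
  calc (∑ k, U.1 k i • K k)ᴴ * ∑ k, U.1 k j • K k
      = (star U.1 * l * U.1) i j • (1 : Matrix a a ℂ) := by
        simp only [star_eq_conjTranspose, conjTranspose_sum, conjTranspose_smul, Matrix.sum_mul,
          Matrix.mul_sum, Matrix.smul_mul, Matrix.mul_smul, hl, smul_smul, Matrix.mul_apply,
          conjTranspose_apply, Finset.sum_smul, Finset.smul_sum, Finset.mul_sum, mul_comm,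
          mul_left_comm]
    _ = if i = j then hherm.eigenvalues i • 1 else 0 := by
        rw [hdiag, diagonal_apply, ite_smul, zero_smul]
        rfl

theorem IsKnillLaflamme.exists_isOrthogonalMixture [DecidableEq κ] [Nonempty a]
    {K : κ → Matrix b a ℂ} (hK : IsKnillLaflamme K) (hop : IsQuantumOperation (krausMap K)) :
    ∃ (s : Finset κ) (p : s → ℝ) (W : s → Matrix b a ℂ),
      IsOrthogonalMixture p W (krausMap K) := by
  obtain ⟨F, D, hFK, hF⟩ := hK.exists_diagonal
  have hD : ∀ i, (F i)ᴴ * F i = D i • 1 := fun i => by rw [hF, if_pos rfl]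
  have hF0 : ∀ i, D i = 0 → F i = 0 := fun i hi =>
    conjTranspose_mul_self_eq_zero.mp (by rw [hD, hi, zero_smul])
  let s : Finset κ := {i | D i ≠ 0}
  have hpos : ∀ i : s, 0 < D i := fun i =>
    (nonneg_of_conjTranspose_mul_self_eq_smul_one (hD i)).lt_of_ne'
      (Finset.mem_filter.mp i.2).2
  have hsqrt : ∀ i : s, √(D i) * √(D i) = D i := fun i => Real.mul_self_sqrt (hpos i).le
  refine ⟨s, fun i => D i, fun i => (√(D i))⁻¹ • F i, hpos, ?_, fun i j => ?_, ?_⟩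
  · have hsum : (∑ i, D i) • (1 : Matrix a a ℂ) = (1 : ℝ) • 1 := by
      have hF1 : ∑ i, (F i)ᴴ * F i = 1 := isQuantumOperation_krausMap_iff.mp (hFK ▸ hop)
      rw [one_smul, Finset.sum_smul]
      exact (Finset.sum_congr rfl fun i _ => hD i).symm.trans hF1
    rw [Finset.sum_coe_sort s D, Finset.sum_filter_ne_zero]
    exact smul_left_injective ℝ one_ne_zero hsum
  · rw [conjTranspose_smul, star_trivial, Matrix.smul_mul, Matrix.mul_smul, smul_smul, hF]
    rcases eq_or_ne i j with rfl | hij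
    · rw [if_pos rfl, if_pos rfl, smul_smul, ← mul_inv, hsqrt, inv_mul_cancel₀ (hpos i).ne',
        one_smul]
    · rw [if_neg (Subtype.coe_injective.ne hij), if_neg hij, smul_zero]
  · have hterm : ∀ i : s, D i • conjMap ((√(D i))⁻¹ • F i) = conjMap (F i) := fun i => by
      rw [conjMap_smul, smul_smul, ← mul_inv, hsqrt, mul_inv_cancel₀ (hpos i).ne', one_smul]
    rw [Finset.sum_congr rfl fun i _ => hterm i, Finset.sum_coe_sort s fun i => conjMap (F i),
      ← hFK, krausMap]
    refine (Finset.sum_filter_of_ne (p := fun i => D i ≠ 0) fun i _ hi hDi => hi ?_).symm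
    rw [hF0 i hDi, conjMap_zero]

end KnillLaflamme

section Recovery

variable {a b κ : Type*} [Fintype a] [Fintype b] [DecidableEq a] [DecidableEq κ]

-- `R` undoes each `W i` on its range and prepares a fixed basis state on the orthogonal complement
-- of all the ranges, onto which `Q` projects.
theorem exists_isQuantumOperation_comp_conjMap_eq_id [Nonempty a] [Finite κ]
    {W : κ → Matrix b a ℂ} (hW : ∀ i j, (W i)ᴴ * W j = if i = j then 1 else 0) :
    ∃ R : Matrix b b ℂ →ₗ[ℂ] Matrix a a ℂ, IsQuantumOperation R ∧
      ∀ j, R ∘ₗ conjMap (W j) = LinearMap.id := by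
  classical
  cases nonempty_fintype κ
  obtain ⟨x⟩ := ‹Nonempty a›
  let Q : Matrix b b ℂ := 1 - ∑ i, W i * (W i)ᴴ
  have hQW : ∀ j, Q * W j = 0 := fun j => by
    rw [Matrix.sub_mul, Matrix.one_mul, Matrix.sum_mul, Fintype.sum_eq_single j, Matrix.mul_assoc,
      hW, if_pos rfl, Matrix.mul_one, sub_self]
    intro i hij
    rw [Matrix.mul_assoc, hW, if_neg hij, Matrix.mul_zero]
  have hQ : Qᴴ * Q = Q := by
    have hQh : Qᴴ = Q := by simp [Q, conjTranspose_sum]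
    calc Qᴴ * Q = Q - ∑ i, Q * W i * (W i)ᴴ := by
          rw [hQh]
          nth_rw 2 [show Q = 1 - ∑ i, W i * (W i)ᴴ from rfl]
          simp only [Matrix.mul_sub, Matrix.mul_one, Matrix.mul_sum, Matrix.mul_assoc]
      _ = Q := by simp [hQW]
  let P : b → Matrix a b ℂ := fun y => single x y 1
  have hP : ∑ y, (P y)ᴴ * P y = 1 := by
    simpa only [P, conjTranspose_single, star_one, single_mul_single_same, mul_one] using
      sum_single_one
  refine ⟨krausMap (Sum.elim (fun i => (W i)ᴴ) fun y => P y * Q),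
    isQuantumOperation_krausMap_iff.mpr ?_, fun j => ?_⟩
  · calc _ = ∑ i, W i * (W i)ᴴ + Qᴴ * (∑ y, (P y)ᴴ * P y) * Q := by
          simp only [Fintype.sum_sum_type, Sum.elim_inl, Sum.elim_inr, conjTranspose_conjTranspose,
            conjTranspose_mul, Matrix.mul_sum, Matrix.sum_mul, Matrix.mul_assoc]
      _ = 1 := by rw [hP, Matrix.mul_one, hQ, add_sub_cancel]
  · rw [krausMap_comp_conjMap, krausMap, Fintype.sum_sum_type]
    simp [hW, Matrix.mul_assoc, hQW, conjMap_zero, conjMap_one, apply_ite conjMap]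

namespace IsOrthogonalMixture

variable [Fintype κ] {p : κ → ℝ} {W : κ → Matrix b a ℂ} {E : Matrix a a ℂ →ₗ[ℂ] Matrix b b ℂ}

theorem isReversible [Nonempty a] (hE : IsOrthogonalMixture p W E) (S : Set (Matrix a a ℂ)) :
    IsReversible E S := by
  obtain ⟨R, hR, hRW⟩ := exists_isQuantumOperation_comp_conjMap_eq_id hE.orthonormal
  refine ⟨R, hR, fun ρ _ => ?_⟩
  have hRW' : ∀ i, R (conjMap (W i) ρ) = ρ := fun i => LinearMap.congr_fun (hRW i) ρ
  simp [hE.eq_sum, LinearMap.sum_apply, hRW', ← Finset.sum_smul, hE.sum_eq_one]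

theorem conjTranspose_mul_apply (hE : IsOrthogonalMixture p W E) (m : κ) (ρ : Matrix a a ℂ) :
    (W m)ᴴ * E ρ = p m • (ρ * (W m)ᴴ) := by
  have hterm : ∀ i, (W m)ᴴ * conjMap (W i) ρ = if m = i then ρ * (W m)ᴴ else 0 := fun i => by
    rw [conjMap_apply, Matrix.mul_assoc, ← Matrix.mul_assoc (W m)ᴴ, hE.orthonormal]
    split_ifs with hmi
    · rw [Matrix.one_mul, hmi]
    · rw [Matrix.zero_mul]
  simp [hE.eq_sum, LinearMap.sum_apply, Matrix.mul_sum, hterm]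

theorem weight_eq_one [Nonempty a] (hE : IsOrthogonalMixture p W E) (hpure : IsPureStateChannel E)
    (m : κ) : p m = 1 := by
  obtain ⟨ρ, hρ⟩ := exists_isPureState (a := a)
  have hρ0 : ρ ≠ 0 := by
    rintro rfl
    simpa using hρ.isDensity.2
  have hcompress : (W m)ᴴ * E ρ * W m = p m • ρ := by
    rw [hE.conjTranspose_mul_apply, Matrix.smul_mul, Matrix.mul_assoc, hE.orthonormal, if_pos rfl,
      Matrix.mul_one]
  have hsq : (p m * p m) • ρ = p m • ρ := by
    calc (p m * p m) • ρ = p m • (ρ * (p m • ρ)) := by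
          rw [Matrix.mul_smul, hρ.mul_self, smul_smul]
      _ = p m • (ρ * (W m)ᴴ) * (E ρ * W m) := by
          simp only [← hcompress, Matrix.smul_mul, Matrix.mul_assoc]
      _ = (W m)ᴴ * (E ρ * E ρ) * W m := by
          rw [← hE.conjTranspose_mul_apply]
          simp only [Matrix.mul_assoc]
      _ = p m • ρ := by rw [(hpure ρ hρ).mul_self, hcompress]
  have h := smul_left_injective ℝ hρ0 hsq
  exact mul_left_cancel₀ (hE.pos m).ne' (h.trans (mul_one _).symm)

theorem exists_isometry [Nonempty a] (hE : IsOrthogonalMixture p W E)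
    (hpure : IsPureStateChannel E) : ∃ V : Matrix b a ℂ, Vᴴ * V = 1 ∧ E = conjMap V := by
  have hp : ∀ m, p m = 1 := hE.weight_eq_one hpure
  have hcard : Fintype.card κ = 1 := by
    have hsum := hE.sum_eq_one
    simp only [hp, Finset.sum_const, Finset.card_univ, nsmul_eq_mul, mul_one] at hsum
    exact_mod_cast hsum
  obtain ⟨m, hm⟩ := Fintype.card_eq_one_iff.mp hcard
  refine ⟨W m, by rw [hE.orthonormal, if_pos rfl], ?_⟩
  rw [hE.eq_sum, Fintype.sum_eq_single m fun i hi => absurd (hm i) hi, hp, one_smul]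

end IsOrthogonalMixture

end Recovery

section ComplementaryChannels

variable {a b κ : Type*} [Fintype b]

theorem IsPureStateChannel.exists_isometry [Fintype a] [DecidableEq a] [Nonempty a]
    {E : Matrix a a ℂ →ₗ[ℂ] Matrix b b ℂ}
    (hpure : IsPureStateChannel E) (hE : IsQuantumOperation E)
    (hrev : IsReversible E {ρ | IsDensity ρ}) : ∃ V : Matrix b a ℂ, Vᴴ * V = 1 ∧ E = conjMap V := by
  classical
  obtain ⟨K, rfl⟩ := hE.exists_eq_krausMap
  obtain ⟨s, p, W, hW⟩ := hrev.isKnillLaflamme.exists_isOrthogonalMixture hE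
  exact hW.exists_isometry hpure

/-- The Kraus operators of the complementary channel, whose output is the environment `ℂ^κ` that
labels the errors `K i`: they are obtained by exchanging the roles of `b` and `κ`. -/
def complementaryKraus (K : κ → Matrix b a ℂ) : b → Matrix κ a ℂ :=
  fun s => of fun i x => K i s x

theorem krausMap_complementaryKraus_apply [Fintype a] (K : κ → Matrix b a ℂ)
    (ρ : Matrix a a ℂ) (i j : κ) :
    krausMap (complementaryKraus K) ρ i j = ((K j)ᴴ * K i * ρ).trace := by
  rw [Matrix.mul_assoc, Matrix.trace_mul_comm]
  simp [krausMap_apply, complementaryKraus, trace, Matrix.sum_apply, Matrix.mul_apply]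

variable [Fintype κ]

theorem sum_complementaryKraus (K : κ → Matrix b a ℂ) :
    ∑ s, (complementaryKraus K s)ᴴ * complementaryKraus K s = ∑ i, (K i)ᴴ * K i := by
  ext x y
  simp only [Matrix.sum_apply, Matrix.mul_apply]
  exact Finset.sum_comm

variable [Fintype a]

theorem isReversible_krausMap_iff [DecidableEq a] [Nonempty a] {K : κ → Matrix b a ℂ}
    (hK : IsQuantumOperation (krausMap K)) :
    IsReversible (krausMap K) {ρ | IsDensity ρ} ↔ IsKnillLaflamme K := by
  classical
  refine ⟨IsReversible.isKnillLaflamme, fun h => ?_⟩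
  obtain ⟨s, p, W, hW⟩ := h.exists_isOrthogonalMixture hK
  exact hW.isReversible _

theorem isVanishing_krausMap_complementaryKraus_iff [DecidableEq a] [Nonempty a]
    {K : κ → Matrix b a ℂ} (hK : IsQuantumOperation (krausMap K)) :
    IsVanishing (krausMap (complementaryKraus K)) {ρ | IsDensity ρ} ↔ IsKnillLaflamme K := by
  constructor
  · rintro ⟨ρ₀, -, hρ₀⟩
    refine ⟨ρ₀ᵀ, fun i j => trace_mul_eq_const_iff.mp fun ρ hρ => ?_⟩
    rw [← krausMap_complementaryKraus_apply, hρ₀ ρ hρ, transpose_apply]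
  · rintro ⟨l, hl⟩
    have hconst : ∀ ρ, IsDensity ρ → krausMap (complementaryKraus K) ρ = lᵀ := fun ρ hρ => by
      ext i j
      rw [krausMap_complementaryKraus_apply, trace_mul_eq_const_iff.mpr (hl j i) ρ hρ,
        transpose_apply]
    have hcompl : IsQuantumOperation (krausMap (complementaryKraus K)) := by
      rw [isQuantumOperation_krausMap_iff] at hK ⊢
      rw [sum_complementaryKraus, hK]
    obtain ⟨σ, hσ⟩ := exists_isPureState (a := a)
    exact ⟨lᵀ, hconst σ hσ.isDensity ▸ hcompl.isDensity hσ.isDensity, hconst⟩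

theorem isReversible_krausMap_iff_isVanishing_complementaryKraus [Nonempty a]
    {K : κ → Matrix b a ℂ} (hK : IsQuantumOperation (krausMap K)) :
    IsReversible (krausMap K) {ρ | IsDensity ρ} ↔
      IsVanishing (krausMap (complementaryKraus K)) {ρ | IsDensity ρ} := by
  classical
  exact (isReversible_krausMap_iff hK).trans
    (isVanishing_krausMap_complementaryKraus_iff hK).symm

end ComplementaryChannels

section Isometries

variable {a b : Type*} [Fintype a] [Fintype b] [DecidableEq a] {V : Matrix b a ℂ}

theorem isQuantumOperation_conjMap_iff : IsQuantumOperation (conjMap V) ↔ Vᴴ * V = 1 := by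
  rw [← krausMap_unique fun _ : Unit => V, isQuantumOperation_krausMap_iff, Fintype.sum_unique]

theorem isReversible_conjMap [Nonempty a] (hV : Vᴴ * V = 1) (S : Set (Matrix a a ℂ)) :
    IsReversible (conjMap V) S := by
  obtain ⟨R, hR, hRV⟩ :=
    exists_isQuantumOperation_comp_conjMap_eq_id (W := fun _ : Unit => V) (by simp [hV])
  exact ⟨R, hR, fun ρ _ => LinearMap.congr_fun (hRV ()) ρ⟩

theorem isPureStateChannel_conjMap (hV : Vᴴ * V = 1) : IsPureStateChannel (conjMap V) := by
  rintro ρ ⟨ψ, hψ, rfl⟩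
  refine ⟨V *ᵥ ψ, ?_, ?_⟩
  · rw [star_mulVec, ← dotProduct_mulVec, mulVec_mulVec, hV, one_mulVec, hψ]
  · rw [conjMap_apply, mul_vecMulVec, vecMulVec_mul, star_mulVec]

end Isometries

section PartialTraces

variable {a b c κ : Type*}

/-- The Kraus operators `(1 ⊗ ⟨k|) V` of the channel `Tr_κ (V · V*)`. -/
def sliceKraus (e : c ≃ b × κ) (V : Matrix c a ℂ) (k : κ) : Matrix b a ℂ :=
  V.submatrix (fun i => e.symm (i, k)) id

theorem sliceKraus_trans_prodComm (e : c ≃ b × κ) (V : Matrix c a ℂ) :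
    sliceKraus (e.trans (Equiv.prodComm b κ)) V = complementaryKraus (sliceKraus e V) := rfl

variable [Fintype κ]

theorem partialTrace_apply (e : c ≃ b × κ) (M : Matrix c c ℂ) (i j : b) :
    partialTrace e M i j = ∑ k, M (e.symm (i, k)) (e.symm (j, k)) := rfl

theorem partialTrace_trans_prodCongr {b' κ' : Type*} [Fintype κ'] (e : c ≃ b × κ) (f : b ≃ b')
    (g : κ ≃ κ') :
    partialTrace (e.trans (f.prodCongr g)) =
      (reindexLinearEquiv ℂ ℂ f f).toLinearMap ∘ₗ partialTrace e := by
  ext1 M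
  ext i j
  exact g.symm.sum_comp fun k => M (e.symm (f.symm i, k)) (e.symm (f.symm j, k))

theorem partialTrace_comp_partialTrace {κ' : Type*} [Fintype κ'] (e : c ≃ b × κ)
    (e' : b ≃ a × κ') :
    partialTrace e' ∘ₗ partialTrace e =
      partialTrace (e.trans ((e'.prodCongr (Equiv.refl κ)).trans (Equiv.prodAssoc a κ' κ))) := by
  ext1 M
  ext i j
  simp [partialTrace_apply, Fintype.sum_prod_type]

theorem partialTrace_comp_conjMap [Fintype a] (e : c ≃ b × κ) (V : Matrix c a ℂ) :
    partialTrace e ∘ₗ conjMap V = krausMap (sliceKraus e V) := by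
  ext1 ρ
  ext i j
  simp [partialTrace_apply, conjMap_apply, krausMap_apply, sliceKraus, Matrix.sum_apply,
    Matrix.mul_apply]

theorem sum_sliceKraus [Fintype b] [Fintype c] (e : c ≃ b × κ) (V : Matrix c a ℂ) :
    ∑ k, (sliceKraus e V k)ᴴ * sliceKraus e V k = Vᴴ * V := by
  ext x y
  simp only [Matrix.sum_apply, Matrix.mul_apply]
  rw [Finset.sum_comm, ← Fintype.sum_prod_type', ← e.symm.sum_comp]
  rfl

theorem isReversible_partialTrace_iff_isVanishing_partialTrace [Fintype a] [DecidableEq a]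
    [Nonempty a] [Fintype b] [Fintype c] {V : Matrix c a ℂ} (hV : Vᴴ * V = 1) (e : c ≃ b × κ) :
    IsReversible (partialTrace e ∘ₗ conjMap V) {ρ | IsDensity ρ} ↔
      IsVanishing (partialTrace (e.trans (Equiv.prodComm b κ)) ∘ₗ conjMap V)
        {ρ | IsDensity ρ} := by
  rw [partialTrace_comp_conjMap, partialTrace_comp_conjMap, sliceKraus_trans_prodComm]
  refine isReversible_krausMap_iff_isVanishing_complementaryKraus ?_
  rw [isQuantumOperation_krausMap_iff, sum_sliceKraus, hV]

-- Stinespring's theorem: `V` stacks the Kraus operators of `E`.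
theorem IsQuantumOperation.exists_isometry_partialTrace [Fintype a] [DecidableEq a] [Fintype b]
    [Fintype c] {E : Matrix a a ℂ →ₗ[ℂ] Matrix b b ℂ} (hE : IsQuantumOperation E)
    (e : c ≃ b × (a × b)) :
    ∃ V : Matrix c a ℂ, Vᴴ * V = 1 ∧ partialTrace e ∘ₗ conjMap V = E := by
  obtain ⟨K, rfl⟩ := hE.exists_eq_krausMap
  let V : Matrix c a ℂ := of fun x i => K (e x).2 (e x).1 i
  have hslice : sliceKraus e V = K := by
    ext k i x
    simp [sliceKraus, V]
  refine ⟨V, ?_, ?_⟩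
  · rw [← sum_sliceKraus e, hslice, isQuantumOperation_krausMap_iff.mp hE]
  · rw [partialTrace_comp_conjMap, hslice]

end PartialTraces

section ShareLabels

variable {ι : Type*} [DecidableEq ι]

/-- The labels of the complement of `X` are the labels outside of `X`. -/
def complLabelEquiv [Fintype ι] (d : ι → ℕ) (X : Finset ι) :
    (∀ i : {i // i ∉ X}, Fin (d i)) ≃ SubLabel d Xᶜ :=
  Equiv.piCongrLeft' _ (Equiv.subtypeEquivRight fun _ => Finset.mem_compl.symm)

/-- The labels of `X` are the labels outside of the complement of `X`. -/
def notMemComplLabelEquiv [Fintype ι] (d : ι → ℕ) (X : Finset ι) :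
    SubLabel d X ≃ ∀ i : {i // i ∉ Xᶜ}, Fin (d i) :=
  Equiv.piCongrLeft' _ (Equiv.subtypeEquivRight fun _ => by simp)

/-- The labels of a set of shares do not change when a share is added. -/
def mapSomeLabelEquiv (d : ι → ℕ) (z : ℕ) (X : Finset ι) :
    SubLabel (addShare d z) (X.map Function.Embedding.some) ≃ SubLabel d X where
  toFun x i := x ⟨some i, by simp [i.2]⟩
  invFun x
    | ⟨some i, hi⟩ => x ⟨i, by simpa using hi⟩
    | ⟨none, hi⟩ => absurd hi (by simp)
  left_inv x := by
    funext ⟨o, ho⟩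
    cases o with
    | none => simp at ho
    | some i => rfl
  right_inv _ := rfl

/-- The labels outside of a set of old shares, when a share is added. -/
def notMemMapSomeLabelEquiv (d : ι → ℕ) (z : ℕ) (X : Finset ι) :
    (∀ o : {o // o ∉ X.map Function.Embedding.some}, Fin (addShare d z o)) ≃
      (∀ i : {i // i ∉ X}, Fin (d i)) × Fin z where
  toFun x := (fun i => x ⟨some i, by simpa using i.2⟩, x ⟨none, by simp⟩)
  invFun x
    | ⟨some i, hi⟩ => x.1 ⟨i, by simpa using hi⟩
    | ⟨none, _⟩ => x.2
  left_inv x := by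
    funext ⟨o, ho⟩
    cases o <;> rfl
  right_inv _ := rfl

end ShareLabels

section Schemes

variable {ι : Type*} [Fintype ι] [DecidableEq ι] {h : ℕ} {d : ι → ℕ}

theorem restrict_compl (W : Encoder h d) (X : Finset ι) :
    restrict W Xᶜ =
      (reindexLinearEquiv ℂ ℂ (complLabelEquiv d X) (complLabelEquiv d X)).toLinearMap ∘ₗ
      partialTrace ((Equiv.piEquivPiSubtypeProd (· ∈ X) fun i => Fin (d i)).trans
        (Equiv.prodComm _ _)) ∘ₗ W := by
  rw [← LinearMap.comp_assoc, ← partialTrace_trans_prodCongr _ _ (notMemComplLabelEquiv d X)]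
  exact congrArg (fun e => partialTrace e ∘ₗ W) (Equiv.ext fun _ => rfl)

theorem isPureScheme_conjMap (h0 : 0 < h) {V : Matrix (Label d) (Fin h) ℂ} (hV : Vᴴ * V = 1) :
    IsPureScheme (conjMap V : Encoder h d) :=
  have : Nonempty (Fin h) := ⟨⟨0, h0⟩⟩
  ⟨⟨isQuantumOperation_conjMap_iff.mpr hV, isReversible_conjMap hV _⟩,
    isPureStateChannel_conjMap hV⟩

namespace IsPureScheme

variable {W : Encoder h d}

theorem isQualified_iff_isForbidden_compl (hW : IsPureScheme W) (h0 : 0 < h) (X : Finset ι) :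
    IsQualified W X ↔ IsForbidden W Xᶜ := by
  have : Nonempty (Fin h) := ⟨⟨0, h0⟩⟩
  obtain ⟨V, hV, rfl⟩ := hW.2.exists_isometry hW.1.1 hW.1.2
  rw [IsForbidden, restrict_compl, isVanishing_reindex_comp_iff]
  exact isReversible_partialTrace_iff_isVanishing_partialTrace hV _

theorem isForbidden_iff_isQualified_compl (hW : IsPureScheme W) (h0 : 0 < h) (X : Finset ι) :
    IsForbidden W X ↔ IsQualified W Xᶜ := by
  rw [hW.isQualified_iff_isForbidden_compl h0, compl_compl]

theorem isIntermediate_iff_isIntermediate_compl (hW : IsPureScheme W) (h0 : 0 < h)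
    (X : Finset ι) : IsIntermediate W X ↔ IsIntermediate W Xᶜ := by
  rw [IsIntermediate, IsIntermediate, ← hW.isQualified_iff_isForbidden_compl h0,
    ← hW.isForbidden_iff_isQualified_compl h0, and_comm]

end IsPureScheme

section AddShare

variable {z : ℕ} (W : Encoder h (addShare d z)) (X : Finset ι)

theorem reindex_restrict_map_some :
    (reindexLinearEquiv ℂ ℂ (mapSomeLabelEquiv d z X) (mapSomeLabelEquiv d z X)).toLinearMap ∘ₗ
      restrict W (X.map Function.Embedding.some) = restrict (discardShare W) X := by
  rw [restrict, restrict, discardShare, ← LinearMap.comp_assoc, ← LinearMap.comp_assoc,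
    partialTrace_comp_partialTrace,
    ← partialTrace_trans_prodCongr _ _ (notMemMapSomeLabelEquiv d z X)]
  exact congrArg (fun e => partialTrace e ∘ₗ W) (Equiv.ext fun _ => rfl)

theorem isQualified_map_some_iff :
    IsQualified W (X.map Function.Embedding.some) ↔ IsQualified (discardShare W) X := by
  rw [IsQualified, IsQualified, ← reindex_restrict_map_some, isReversible_reindex_comp_iff]

theorem isForbidden_map_some_iff :
    IsForbidden W (X.map Function.Embedding.some) ↔ IsForbidden (discardShare W) X := by
  rw [IsForbidden, IsForbidden, ← reindex_restrict_map_some, isVanishing_reindex_comp_iff]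

theorem isIntermediate_map_some_iff :
    IsIntermediate W (X.map Function.Embedding.some) ↔ IsIntermediate (discardShare W) X :=
  and_congr (isQualified_map_some_iff W X).not (isForbidden_map_some_iff W X).not

end AddShare

theorem IsQuantumOperation.exists_isometry_discardShare {W : Encoder h d}
    (hW : IsQuantumOperation W) :
    ∃ (z : ℕ) (V : Matrix (Label (addShare d z)) (Fin h) ℂ), Vᴴ * V = 1 ∧
      discardShare (conjMap V : Encoder h (addShare d z)) = W := by
  let e := Fintype.equivFin (Fin h × Label d)
  obtain ⟨V, hV, hVW⟩ := hW.exists_isometry_partialTrace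
    ((splitShare d _).trans ((Equiv.refl _).prodCongr e.symm))
  refine ⟨_, V, hV, ?_⟩
  rw [partialTrace_trans_prodCongr, reindexLinearEquiv_refl_refl] at hVW
  exact hVW

/-- The access structure on `N ∪ {Z}` of the pure state schemes that realize schemes with a given
access structure on `N` by discarding the share `Z = none`. -/
def AccessStructure.dilate (A : AccessStructure ι) : AccessStructure (Option ι) where
  forbidden := {Y | if none ∈ Y then Yᶜ.eraseNone ∈ A.qualified else Y.eraseNone ∈ A.forbidden}
  intermediate :=
    {Y | if none ∈ Y then Yᶜ.eraseNone ∈ A.intermediate else Y.eraseNone ∈ A.intermediate}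
  qualified := {Y | if none ∈ Y then Yᶜ.eraseNone ∈ A.forbidden else Y.eraseNone ∈ A.qualified}

theorem IsPureScheme.accessStructure_eq_dilate {z : ℕ} {W : Encoder h (addShare d z)}
    (hW : IsPureScheme W) (h0 : 0 < h) :
    accessStructure W = (accessStructure (discardShare W)).dilate := by
  have hmap : ∀ Y : Finset (Option ι), none ∉ Y →
      Y.eraseNone.map Function.Embedding.some = Y := fun Y hY => by
    rw [Finset.map_some_eraseNone, Finset.erase_eq_of_notMem hY]
  have hcompl : ∀ Y : Finset (Option ι), none ∈ Y →
      Yᶜ.eraseNone.map Function.Embedding.some = Yᶜ := fun Y hY => hmap _ (by simpa using hY)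
  simp only [accessStructure, AccessStructure.dilate, AccessStructure.mk.injEq, Set.ext_iff,
    Set.mem_ofPred_eq, ← isQualified_map_some_iff, ← isForbidden_map_some_iff,
    ← isIntermediate_map_some_iff]
  refine ⟨fun Y => ?_, fun Y => ?_, fun Y => ?_⟩ <;> split_ifs with hY
  · rw [hcompl Y hY, hW.isForbidden_iff_isQualified_compl h0]
  · rw [hmap Y hY]
  · rw [hcompl Y hY, hW.isIntermediate_iff_isIntermediate_compl h0]
  · rw [hmap Y hY]
  · rw [hcompl Y hY, hW.isQualified_iff_isForbidden_compl h0]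
  · rw [hmap Y hY]

end Schemes

end QSS

theorem lemma1_general {ι : Type*} [Fintype ι] [DecidableEq ι] :
    ∃ F : QSS.AccessStructure ι → QSS.AccessStructure (Option ι),
      ∀ (h : ℕ) (d : ι → ℕ) (W : QSS.Encoder h d), 0 < h → QSS.IsQuantumOperation W →
        (∃ (z : ℕ) (V : Matrix (QSS.Label (QSS.addShare d z)) (Fin h) ℂ),
          V.conjTranspose * V = 1 ∧
          QSS.IsPureScheme (QSS.conjMap V : QSS.Encoder h (QSS.addShare d z)) ∧
          QSS.discardShare (QSS.conjMap V : QSS.Encoder h (QSS.addShare d z)) = W) ∧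
        (∀ (z : ℕ) (W' : QSS.Encoder h (QSS.addShare d z)),
          QSS.IsPureScheme W' → QSS.discardShare W' = W →
          QSS.accessStructure W' = F (QSS.accessStructure W) ∧
          (∀ X : Finset ι,
            (QSS.IsQualified W' (X.map Function.Embedding.some) ↔ QSS.IsQualified W X) ∧
            (QSS.IsForbidden W' (X.map Function.Embedding.some) ↔ QSS.IsForbidden W X) ∧
            (QSS.IsIntermediate W' (X.map Function.Embedding.some) ↔ QSS.IsIntermediate W X)) ∧
          (∀ Y : Finset (Option ι),
            (QSS.IsQualified W' Y ↔ QSS.IsForbidden W' Yᶜ) ∧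
            (QSS.IsForbidden W' Y ↔ QSS.IsQualified W' Yᶜ) ∧
            (QSS.IsIntermediate W' Y ↔ QSS.IsIntermediate W' Yᶜ))) := by
  refine ⟨QSS.AccessStructure.dilate, fun h d W h0 hW => ⟨?_, ?_⟩⟩
  · obtain ⟨z, V, hV, hVW⟩ := hW.exists_isometry_discardShare
    exact ⟨z, V, hV, QSS.isPureScheme_conjMap h0 hV, hVW⟩
  · rintro z W' hW' rfl
    exact ⟨hW'.accessStructure_eq_dilate h0,
      fun X => ⟨QSS.isQualified_map_some_iff W' X, QSS.isForbidden_map_some_iff W' X,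
        QSS.isIntermediate_map_some_iff W' X⟩,
      fun Y => ⟨hW'.isQualified_iff_isForbidden_compl h0 Y,
        hW'.isForbidden_iff_isQualified_compl h0 Y,
        hW'.isIntermediate_iff_isIntermediate_compl h0 Y⟩⟩

theorem lemma1 {ι : Type*} [Fintype ι] [DecidableEq ι] :
    ∃ F : QSS.AccessStructure ι → QSS.AccessStructure (Option ι),
      ∀ (h : ℕ) (d : ι → ℕ) (W : QSS.Encoder h d), 0 < h → QSS.IsMixedScheme W →
        -- realization by discarding one share of a pure state scheme given by an isometry
        (∃ (z : ℕ) (V : Matrix (QSS.Label (QSS.addShare d z)) (Fin h) ℂ),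
          V.conjTranspose * V = 1 ∧
          QSS.IsPureScheme (QSS.conjMap V : QSS.Encoder h (QSS.addShare d z)) ∧
          QSS.discardShare (QSS.conjMap V : QSS.Encoder h (QSS.addShare d z)) = W) ∧
        -- every such pure state scheme has the access structure determined by that of `W`
        (∀ (z : ℕ) (W' : QSS.Encoder h (QSS.addShare d z)),
          QSS.IsPureScheme W' → QSS.discardShare W' = W →
          QSS.accessStructure W' = F (QSS.accessStructure W) ∧
          (∀ X : Finset ι,
            (QSS.IsQualified W' (X.map Function.Embedding.some) ↔ QSS.IsQualified W X) ∧
            (QSS.IsForbidden W' (X.map Function.Embedding.some) ↔ QSS.IsForbidden W X) ∧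
            (QSS.IsIntermediate W' (X.map Function.Embedding.some) ↔ QSS.IsIntermediate W X)) ∧
          (∀ Y : Finset (Option ι), none ∈ Y →
            (QSS.IsQualified W' Y ↔ QSS.IsForbidden W' Yᶜ) ∧
            (QSS.IsForbidden W' Y ↔ QSS.IsQualified W' Yᶜ) ∧
            (QSS.IsIntermediate W' Y ↔ QSS.IsIntermediate W' Yᶜ))) := by
  obtain ⟨F, hF⟩ := lemma1_general (ι := ι)
  exact ⟨F, fun h d W h0 hW => (hF h d W h0 hW.1.1).imp_right fun hF' z W' hW' hd =>
    (hF' z W' hW' hd).imp_right <| And.imp_right fun hY Y _ => hY Y⟩
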